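/- For a lattice $\Lambda\subset\mathbb R^n$ let $\Theta_\Lambda(z)=\sum_{x\in\Lambda}e^{\pi i\|x\|^2z}$ (for $\operatorname{Im} z>0$) be its theta function, and for real $y>0$ let $\Xi_\Lambda(y)=\Theta_{\mathbb Z^n}(yi)/\Theta_\Lambda(yi)$ be its secrecy function. Let $E_8\subset\mathbb R^8$ be the lattice of all vectors whose coordinates are either all in $\mathbb Z$ or all in $\mathbb Z+\tfrac12$ and whose coordinate sum is an even integer. Then for every $y>0$ the series $\Theta_{\mathbb Z^8}(yi)$ and $\Theta_{E_8}(yi)$ converge absolutely, $\Theta_{E_8}(yi)\neq 0$, and $$\Xi_{E_8}(y)\le \Xi_{E_8}(1).$$ -/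

import Mathlib

/-- The theta function `Θ_Λ(z) = ∑_{x ∈ Λ} e^{π i ‖x‖² z}` of a lattice `Λ` in Euclidean space. -/
noncomputable def latticeTheta {n : ℕ} (Λ : AddSubgroup (EuclideanSpace ℝ (Fin n))) (z : ℂ) : ℂ :=
  ∑' x : Λ, Complex.exp (Real.pi * Complex.I * (‖(x : EuclideanSpace ℝ (Fin n))‖ : ℂ) ^ 2 * z)

/-- The lattice `ℤⁿ`: all vectors with integer coordinates. -/
def integerLattice (n : ℕ) : AddSubgroup (EuclideanSpace ℝ (Fin n)) where
  carrier := {x | ∀ i, ∃ m : ℤ, x i = m}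
  zero_mem' := fun _ => ⟨0, by simp⟩
  add_mem' := by
    intro x y hx hy i
    obtain ⟨a, ha⟩ := hx i
    obtain ⟨b, hb⟩ := hy i
    exact ⟨a + b, by simp [ha, hb]⟩
  neg_mem' := by
    intro x hx i
    obtain ⟨a, ha⟩ := hx i
    exact ⟨-a, by simp [ha]⟩

/-- The lattice `E₈`: all vectors of `ℝ⁸` whose coordinates are all integers or all half-odd
integers, and whose coordinate sum is an even integer. -/
def latticeE8 : AddSubgroup (EuclideanSpace ℝ (Fin 8)) where
  carrier := {x | ((∀ i, ∃ m : ℤ, x i = m) ∨ (∀ i, ∃ m : ℤ, x i = m + 1 / 2)) ∧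
    ∃ k : ℤ, ∑ i, x i = 2 * k}
  zero_mem' := ⟨Or.inl fun _ => ⟨0, by simp⟩, 0, by simp⟩
  add_mem' := by
    rintro x y ⟨hx, k, hk⟩ ⟨hy, l, hl⟩
    refine ⟨?_, k + l, ?_⟩
    · rcases hx with hx | hx <;> rcases hy with hy | hy
      · left; intro i
        obtain ⟨a, ha⟩ := hx i
        obtain ⟨b, hb⟩ := hy i
        exact ⟨a + b, by simp [ha, hb]⟩
      · right; intro i
        obtain ⟨a, ha⟩ := hx i
        obtain ⟨b, hb⟩ := hy i
        exact ⟨a + b, by simp [ha, hb]; ring⟩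
      · right; intro i
        obtain ⟨a, ha⟩ := hx i
        obtain ⟨b, hb⟩ := hy i
        exact ⟨a + b, by simp [ha, hb]; ring⟩
      · left; intro i
        obtain ⟨a, ha⟩ := hx i
        obtain ⟨b, hb⟩ := hy i
        exact ⟨a + b + 1, by simp [ha, hb]; ring⟩
    · simp only [PiLp.add_apply, Finset.sum_add_distrib, hk, hl]
      push_cast; ring
  neg_mem' := by
    rintro x ⟨hx, k, hk⟩
    refine ⟨?_, -k, ?_⟩
    · rcases hx with hx | hx
      · left; intro i
        obtain ⟨a, ha⟩ := hx i
        exact ⟨-a, by simp [ha]⟩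
      · right; intro i
        obtain ⟨a, ha⟩ := hx i
        exact ⟨-a - 1, by simp [ha]; ring⟩
    · simp only [PiLp.neg_apply, Finset.sum_neg_distrib, hk]
      push_cast; ring

/-- On the positive imaginary axis the theta function takes real values. -/
theorem latticeTheta_mul_I {n : ℕ} (Λ : AddSubgroup (EuclideanSpace ℝ (Fin n))) (y : ℝ) :
    latticeTheta Λ (y * Complex.I) =
      ((∑' x : Λ, Real.exp (-Real.pi * ‖(x : EuclideanSpace ℝ (Fin n))‖ ^ 2 * y) : ℝ) : ℂ) := by
  rw [Complex.ofReal_tsum]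
  refine tsum_congr fun x => ?_
  rw [Complex.ofReal_exp]
  congr 1
  push_cast
  linear_combination
    (Real.pi * (‖(x : EuclideanSpace ℝ (Fin n))‖ : ℂ) ^ 2 * y) * Complex.I_sq

/-- The secrecy function `Ξ_Λ(y) = Θ_{ℤⁿ}(yi) / Θ_Λ(yi)`, for `y > 0`. The quotient is a real
number (see `ofReal_secrecyFunction`), so that taking the real part only changes its type. -/
noncomputable def secrecyFunction {n : ℕ} (Λ : AddSubgroup (EuclideanSpace ℝ (Fin n))) (y : ℝ) :
    ℝ :=
  (latticeTheta (integerLattice n) (y * Complex.I) / latticeTheta Λ (y * Complex.I)).re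

theorem ofReal_secrecyFunction {n : ℕ} (Λ : AddSubgroup (EuclideanSpace ℝ (Fin n))) (y : ℝ) :
    (secrecyFunction Λ y : ℂ) =
      latticeTheta (integerLattice n) (y * Complex.I) / latticeTheta Λ (y * Complex.I) := by
  rw [secrecyFunction, latticeTheta_mul_I, latticeTheta_mul_I, ← Complex.ofReal_div,
    Complex.ofReal_re]

/-! Write `θ₂`, `θ₃`, `θ₄` for Jacobi's theta constants as functions of `y > 0`. Splitting a vector
into its coordinates gives `Θ_{ℤ⁸} = θ₃⁸`, and detecting the parity of the coordinate sum with the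
sign `(-1) ^ ∑ xᵢ` gives `Θ_{E₈} = (θ₂⁸ + θ₃⁸ + θ₄⁸) / 2`
(`hasSum_integerLattice`, `hasSum_latticeE8`).

Jacobi's identity `θ₃⁴ = θ₂⁴ + θ₄⁴` (`thetaThree_pow_four`) then yields
`θ₂⁸ + θ₄⁸ ≥ (θ₂⁴ + θ₄⁴)² / 2 = θ₃⁸ / 2`, that is, `Ξ_{E₈} ≤ 4 / 3`. Equality holds at `y = 1`,
because `θ₂(1) = θ₄(1)` by Poisson summation (`thetaTwo_one`).

Jacobi's identity is derived from duplication formulas: cutting `ℤ²` along the parity of `m + n`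
into the pairs `(u + v, u - v)` and the pairs `(u + v + 1, u - v)` expresses `θ₂²`, `θ₃²`, `θ₄²`
at `y` through `θ₂`, `θ₃` at `2 y`, and the identity becomes polynomial. -/

open Real HurwitzZeta

/-! ### Sums over disjoint ranges, over pairs and over tuples of integers -/

lemma HasSum.of_isCompl_range {α β γ : Type*} {F : α → ℝ} {g : β → α} {h : γ → α}
    (hg : g.Injective) (hh : h.Injective) (hc : IsCompl (Set.range g) (Set.range h)) {a b : ℝ}
    (ha : HasSum (F ∘ g) a) (hb : HasSum (F ∘ h) b) : HasSum F (a + b) :=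
  HasSum.add_isCompl hc (hg.hasSum_range_iff.2 ha) (hh.hasSum_range_iff.2 hb)

/-- The pairs of integers with even, respectively odd, sum are those of the form
`(u + v, u - v)`, respectively `(u + v + 1, u - v)`. -/
lemma hasSum_int_prod_of_parity {F : ℤ × ℤ → ℝ} {a b : ℝ}
    (ha : HasSum (fun p : ℤ × ℤ => F (p.1 + p.2, p.1 - p.2)) a)
    (hb : HasSum (fun p : ℤ × ℤ => F (p.1 + p.2 + 1, p.1 - p.2)) b) : HasSum F (a + b) := by
  refine HasSum.of_isCompl_range (g := fun p : ℤ × ℤ => (p.1 + p.2, p.1 - p.2))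
    (h := fun p : ℤ × ℤ => (p.1 + p.2 + 1, p.1 - p.2)) ?_ ?_ ?_ ha hb
  · rintro ⟨u, v⟩ ⟨u', v'⟩ h
    simp only [Prod.mk.injEq] at h ⊢
    omega
  · rintro ⟨u, v⟩ ⟨u', v'⟩ h
    simp only [Prod.mk.injEq] at h ⊢
    omega
  · constructor
    · rw [Set.disjoint_left]
      rintro _ ⟨⟨u, v⟩, rfl⟩ ⟨⟨u', v'⟩, h⟩
      simp only [Prod.mk.injEq] at h
      omega
    · rw [codisjoint_iff_le_sup]
      rintro ⟨m, n⟩ -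
      rcases Int.even_or_odd' (m + n) with ⟨k, hk | hk⟩
      · left
        exact ⟨(k, m - k), Prod.ext (by simp only; omega) (by simp only; omega)⟩
      · right
        exact ⟨(k, m - k - 1), Prod.ext (by simp only; omega) (by simp only; omega)⟩

lemma HasSum.mul_real {α β : Type*} {f : α → ℝ} {g : β → ℝ} {a b : ℝ}
    (hf : HasSum f a) (hg : HasSum g b) : HasSum (fun p : α × β => f p.1 * g p.2) (a * b) :=
  hf.mul hg (summable_mul_of_summable_norm hf.summable.norm hg.summable.norm)

lemma HasSum.prod_fin {f : ℤ → ℝ} {a : ℝ} (hf : HasSum f a) (n : ℕ) :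
    HasSum (fun x : Fin n → ℤ => ∏ i, f (x i)) (a ^ n) := by
  induction n with
  | zero => simp
  | succ n ih =>
    rw [pow_succ', ← (Fin.consEquiv fun _ : Fin (n + 1) => ℤ).hasSum_iff]
    convert hf.mul_real ih using 2 with p
    simp [Fin.consEquiv, Fin.prod_univ_succ]

/-- Half the sum of the plain and the signed product series is the sum over the tuples with even
coordinate sum. -/
lemma hasSum_even_sum {f : ℤ → ℝ} {a b : ℝ} (ha : HasSum f a)
    (hb : HasSum (fun m => (-1) ^ m * f m) b) :
    HasSum (fun x : {x : Fin 8 → ℤ | Even (∑ i, x i)} => ∏ i, f ((x : Fin 8 → ℤ) i))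
      ((a ^ 8 + b ^ 8) / 2) := by
  refine (hasSum_subtype_iff_indicator (f := fun x : Fin 8 → ℤ => ∏ i, f (x i))).2 ?_
  refine (((ha.prod_fin 8).add (hb.prod_fin 8)).div_const 2).congr_fun fun x => ?_
  have hs : ∏ i, ((-1 : ℝ) ^ x i * f (x i)) = (-1) ^ (∑ i, x i) * ∏ i, f (x i) := by
    rw [Finset.prod_mul_distrib]
    simp only [Fin.prod_univ_eight, Fin.sum_univ_eight]
    simp only [zpow_add₀ (show (-1 : ℝ) ≠ 0 by norm_num)]
  rw [hs, Set.indicator_apply]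
  split_ifs with h
  · rw [Even.neg_one_zpow h]; ring
  · rw [(Int.not_even_iff_odd.1 h).neg_one_zpow]; ring

/-! ### Jacobi's theta constants on the imaginary axis -/

/-- The theta constant `θ₂(y) = ∑ₙ exp (-π (n + 1/2)² y)`, with the variable `y` standing for
the point `y i` of the upper half-plane. -/
noncomputable def thetaTwo (y : ℝ) : ℝ := ∑' n : ℤ, rexp (-π * (n + 1 / 2) ^ 2 * y)

/-- The theta constant `θ₃(y) = ∑ₙ exp (-π n² y)`. -/
noncomputable def thetaThree (y : ℝ) : ℝ := ∑' n : ℤ, rexp (-π * (n : ℝ) ^ 2 * y)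

/-- The theta constant `θ₄(y) = ∑ₙ (-1)ⁿ exp (-π n² y)`. -/
noncomputable def thetaFour (y : ℝ) : ℝ := ∑' n : ℤ, (-1) ^ n * rexp (-π * (n : ℝ) ^ 2 * y)

section
variable {y : ℝ}

lemma hasSum_thetaTwo (hy : 0 < y) :
    HasSum (fun n : ℤ => rexp (-π * (n + 1 / 2) ^ 2 * y)) (thetaTwo y) :=
  (hasSum_int_evenKernel (1 / 2) hy).summable.hasSum

lemma hasSum_thetaThree (hy : 0 < y) :
    HasSum (fun n : ℤ => rexp (-π * (n : ℝ) ^ 2 * y)) (thetaThree y) := by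
  have h := (hasSum_int_evenKernel 0 hy).summable.hasSum
  simp only [add_zero] at h
  exact h

lemma summable_neg_one_zpow_mul {f : ℤ → ℝ} (hf : Summable f) :
    Summable fun n => (-1) ^ n * f n := by
  refine Summable.of_norm ?_
  simpa using hf.norm

lemma hasSum_thetaFour (hy : 0 < y) :
    HasSum (fun n : ℤ => (-1) ^ n * rexp (-π * (n : ℝ) ^ 2 * y)) (thetaFour y) :=
  (summable_neg_one_zpow_mul (hasSum_thetaThree hy).summable).hasSum

lemma thetaThree_pos (hy : 0 < y) : 0 < thetaThree y :=
  (hasSum_thetaThree hy).summable.tsum_pos (fun _ => (exp_pos _).le) 0 (exp_pos _)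

/-- The reflection `n ↦ -1 - n` fixes `(n + 1/2)²` and flips the sign `(-1)ⁿ`. -/
lemma hasSum_thetaTwo_signed (hy : 0 < y) :
    HasSum (fun n : ℤ => (-1) ^ n * rexp (-π * (n + 1 / 2) ^ 2 * y)) 0 := by
  have h := (summable_neg_one_zpow_mul (hasSum_thetaTwo hy).summable).hasSum
  have h' := (Equiv.subLeft (-1 : ℤ)).hasSum_iff.2 h
  have h'' : HasSum (fun n : ℤ => -((-1) ^ n * rexp (-π * (n + 1 / 2) ^ 2 * y)))
      (∑' n : ℤ, (-1) ^ n * rexp (-π * (n + 1 / 2) ^ 2 * y)) := by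
    refine h'.congr_fun fun n => ?_
    have h1 : (-1 : ℝ) ^ (-1 - n) = -(-1) ^ n := by
      rcases n.even_or_odd with hn | hn
      · rw [hn.neg_one_zpow, Odd.neg_one_zpow (by grind)]
      · rw [hn.neg_one_zpow, Even.neg_one_zpow (by grind), neg_neg]
    simp only [Function.comp_apply, Equiv.subLeft_apply, h1, Int.cast_sub, Int.cast_neg,
      Int.cast_one]
    rw [← neg_mul]
    congr 3
    ring
  have := h''.unique h.neg
  convert h using 1
  linarith

/-- Poisson summation at the fixed point `y = 1` of `y ↦ 1 / y`. -/
lemma thetaTwo_one : thetaTwo 1 = thetaFour 1 := by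
  have h2 : thetaTwo 1 = evenKernel ((1 / 2 : ℝ) : UnitAddCircle) 1 :=
    (hasSum_thetaTwo one_pos).unique (hasSum_int_evenKernel (1 / 2) one_pos)
  have h4 : (thetaFour 1 : ℂ) = cosKernel ((1 / 2 : ℝ) : UnitAddCircle) 1 := by
    refine (Complex.hasSum_ofReal.2 (hasSum_thetaFour one_pos)).unique ?_
    refine (hasSum_int_cosKernel (1 / 2) one_pos).congr_fun fun n => ?_
    rw [Complex.ofReal_mul]
    congr 1
    rw [show 2 * (π : ℂ) * Complex.I * ((1 / 2 : ℝ) : ℂ) * n = n * (π * Complex.I) by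
      push_cast; ring, Complex.exp_int_mul, Complex.exp_pi_mul_I]
    push_cast
    rfl
  rw [h2, evenKernel_functional_equation]
  simpa using (Complex.ofReal_inj.1 h4).symm

lemma thetaThree_sq (hy : 0 < y) :
    thetaThree y ^ 2 = thetaThree (2 * y) ^ 2 + thetaTwo (2 * y) ^ 2 := by
  have hy2 : 0 < 2 * y := by positivity
  have h3 := (hasSum_thetaThree hy2).mul_real (hasSum_thetaThree hy2)
  have h2 := (hasSum_thetaTwo hy2).mul_real (hasSum_thetaTwo hy2)
  simp only [sq (thetaThree _), sq (thetaTwo _)]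
  refine ((hasSum_thetaThree hy).mul_real (hasSum_thetaThree hy)).unique
    (hasSum_int_prod_of_parity (h3.congr_fun fun p => ?_) (h2.congr_fun fun p => ?_)) <;>
  · simp only [← exp_add]
    congr 1
    push_cast
    ring

lemma thetaFour_sq (hy : 0 < y) :
    thetaFour y ^ 2 = thetaThree (2 * y) ^ 2 - thetaTwo (2 * y) ^ 2 := by
  have hy2 : 0 < 2 * y := by positivity
  have h3 := (hasSum_thetaThree hy2).mul_real (hasSum_thetaThree hy2)
  have h2 := ((hasSum_thetaTwo hy2).mul_real (hasSum_thetaTwo hy2)).neg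
  simp only [sq (thetaThree _), sq (thetaTwo _), sq (thetaFour _), sub_eq_add_neg]
  refine ((hasSum_thetaFour hy).mul_real (hasSum_thetaFour hy)).unique
    (hasSum_int_prod_of_parity (h3.congr_fun fun p => ?_) (h2.congr_fun fun p => ?_))
  · rw [mul_mul_mul_comm, ← zpow_add₀ (by norm_num), Even.neg_one_zpow (by grind), one_mul]
    simp only [← exp_add]
    congr 1
    push_cast
    ring
  · rw [mul_mul_mul_comm, ← zpow_add₀ (by norm_num), Odd.neg_one_zpow (by grind), neg_one_mul]
    simp only [← exp_add]
    congr 2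
    push_cast
    ring

lemma thetaTwo_sq (hy : 0 < y) :
    thetaTwo y ^ 2 = 2 * (thetaTwo (2 * y) * thetaThree (2 * y)) := by
  have hy2 : 0 < 2 * y := by positivity
  -- With `m + 1/2`, `n + 1/2` in place of `m`, `n`, half the sum and half the difference lie in
  -- opposite cosets `ℤ`, `ℤ + 1/2`; on the odd pairs half the sum is `u + 1`, hence the shift.
  have h23 := (hasSum_thetaTwo hy2).mul_real (hasSum_thetaThree hy2)
  have h32 := ((Equiv.addRight (1 : ℤ)).hasSum_iff.2 (hasSum_thetaThree hy2)).mul_real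
    (hasSum_thetaTwo hy2)
  rw [mul_comm (thetaThree _)] at h32
  rw [sq, two_mul]
  refine ((hasSum_thetaTwo hy).mul_real (hasSum_thetaTwo hy)).unique
    (hasSum_int_prod_of_parity (h23.congr_fun fun p => ?_) (h32.congr_fun fun p => ?_)) <;>
  · simp only [Function.comp_apply, Equiv.coe_addRight, ← exp_add]
    congr 1
    push_cast
    ring

/-- Jacobi's identity `θ₃⁴ = θ₂⁴ + θ₄⁴`. -/
lemma thetaThree_pow_four (hy : 0 < y) : thetaThree y ^ 4 = thetaTwo y ^ 4 + thetaFour y ^ 4 := by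
  have h2 := thetaTwo_sq hy
  have h3 := thetaThree_sq hy
  have h4 := thetaFour_sq hy
  calc thetaThree y ^ 4 = (thetaThree y ^ 2) ^ 2 := by ring
    _ = (thetaTwo y ^ 2) ^ 2 + (thetaFour y ^ 2) ^ 2 := by rw [h2, h3, h4]; ring
    _ = _ := by ring

/-! ### The theta series of the two lattices -/

lemma exp_norm_sq_eq_prod {n : ℕ} (x : EuclideanSpace ℝ (Fin n)) :
    rexp (-π * ‖x‖ ^ 2 * y) = ∏ i, rexp (-π * x i ^ 2 * y) := by
  rw [← exp_sum, EuclideanSpace.real_norm_sq_eq, Finset.mul_sum, Finset.sum_mul]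

lemma hasSum_integerLattice (hy : 0 < y) (n : ℕ) :
    HasSum (fun x : integerLattice n => rexp (-π * ‖(x : EuclideanSpace ℝ (Fin n))‖ ^ 2 * y))
      (thetaThree y ^ n) := by
  let g : (Fin n → ℤ) → integerLattice n := fun x => ⟨WithLp.toLp 2 fun i => (x i : ℝ),
    fun i => ⟨x i, rfl⟩⟩
  have hg : g.Bijective := by
    refine ⟨fun x x' h => ?_, fun x => ?_⟩
    · ext i
      have h' := congrArg (fun z : integerLattice n => (z : EuclideanSpace ℝ (Fin n)) i) h
      exact Int.cast_injective (α := ℝ) h'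
    · choose m hm using x.2
      exact ⟨m, Subtype.ext (PiLp.ext fun i => (hm i).symm)⟩
  rw [← (Equiv.ofBijective g hg).hasSum_iff]
  refine ((hasSum_thetaThree hy).prod_fin n).congr_fun fun x => ?_
  exact exp_norm_sq_eq_prod _

/-- The vector `(xᵢ + c)ᵢ` of `E₈`, where `c` is `0` or `1/2` and `∑ xᵢ` is even. -/
noncomputable def shiftedVector (c : ℝ) (hc : c = 0 ∨ c = 1 / 2)
    (x : {x : Fin 8 → ℤ | Even (∑ i, x i)}) : latticeE8 :=
  ⟨WithLp.toLp 2 fun i => ((x : Fin 8 → ℤ) i : ℝ) + c, by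
    obtain ⟨x, k, hk⟩ := x
    have hk' : (∑ i, (x i : ℝ)) = 2 * k := by
      rw [← Int.cast_sum, hk]; push_cast; ring
    rcases hc with rfl | rfl
    · refine ⟨Or.inl fun i => ⟨x i, by simp⟩, k, by simpa using hk'⟩
    · refine ⟨Or.inr fun i => ⟨x i, rfl⟩, k + 2, ?_⟩
      simp only [Finset.sum_add_distrib, hk']
      norm_num
      ring⟩

lemma shiftedVector_apply (c : ℝ) (hc : c = 0 ∨ c = 1 / 2)
    (x : {x : Fin 8 → ℤ | Even (∑ i, x i)}) (i : Fin 8) :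
    (shiftedVector c hc x : EuclideanSpace ℝ (Fin 8)) i = (x : Fin 8 → ℤ) i + c := rfl

lemma shiftedVector_injective (c : ℝ) (hc : c = 0 ∨ c = 1 / 2) :
    (shiftedVector c hc).Injective := by
  intro x x' h
  ext i
  have h' := congrArg (fun z : latticeE8 => (z : EuclideanSpace ℝ (Fin 8)) i) h
  simp only [shiftedVector_apply, add_left_inj] at h'
  exact_mod_cast h'

lemma isCompl_range_shiftedVector :
    IsCompl (Set.range (shiftedVector 0 (Or.inl rfl)))
      (Set.range (shiftedVector (1 / 2) (Or.inr rfl))) := by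
  constructor
  · rw [Set.disjoint_left]
    rintro _ ⟨x, rfl⟩ ⟨x', h⟩
    have h' := congrArg (fun z : latticeE8 => (z : EuclideanSpace ℝ (Fin 8)) 0) h
    simp only [shiftedVector_apply] at h'
    have h2 : (2 * (x' : Fin 8 → ℤ) 0 + 1 : ℝ) = 2 * (x : Fin 8 → ℤ) 0 := by linarith
    norm_cast at h2
    omega
  · rw [codisjoint_iff_le_sup]
    rintro ⟨x, hx, k, hk⟩ -
    obtain hx' | hx' := id hx
    · left
      choose m hm using hx'
      refine ⟨⟨m, k, ?_⟩, Subtype.ext (PiLp.ext fun i => ?_)⟩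
      · simp only [hm] at hk
        norm_cast at hk
        linarith
      · simp [shiftedVector_apply, hm]
    · right
      choose m hm using hx'
      refine ⟨⟨m, k - 2, ?_⟩, Subtype.ext (PiLp.ext fun i => ?_)⟩
      · simp only [hm, Finset.sum_add_distrib] at hk
        have h2 : (∑ i, (m i : ℝ)) = 2 * k - 4 := by
          norm_num at hk
          linarith
        have h3 : ∑ i, m i = 2 * k - 4 := by exact_mod_cast h2
        linarith
      · simp [shiftedVector_apply, hm]

lemma hasSum_latticeE8 (hy : 0 < y) :
    HasSum (fun x : latticeE8 => rexp (-π * ‖(x : EuclideanSpace ℝ (Fin 8))‖ ^ 2 * y))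
      ((thetaTwo y ^ 8 + thetaThree y ^ 8 + thetaFour y ^ 8) / 2) := by
  have h0 := hasSum_even_sum (hasSum_thetaThree hy) (hasSum_thetaFour hy)
  have h1 := hasSum_even_sum (hasSum_thetaTwo hy) (hasSum_thetaTwo_signed hy)
  have h := HasSum.of_isCompl_range
    (F := fun x : latticeE8 => rexp (-π * ‖(x : EuclideanSpace ℝ (Fin 8))‖ ^ 2 * y))
    (shiftedVector_injective 0 (Or.inl rfl)) (shiftedVector_injective (1 / 2) (Or.inr rfl))
    isCompl_range_shiftedVector
    (h0.congr_fun fun x => by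
      simp only [Function.comp_apply, exp_norm_sq_eq_prod, shiftedVector_apply, add_zero])
    (h1.congr_fun fun x => by
      simp only [Function.comp_apply, exp_norm_sq_eq_prod, shiftedVector_apply])
  convert h using 1
  ring

lemma summable_cexp_of_summable_exp {n : ℕ} {Λ : AddSubgroup (EuclideanSpace ℝ (Fin n))}
    (h : Summable fun x : Λ => rexp (-π * ‖(x : EuclideanSpace ℝ (Fin n))‖ ^ 2 * y)) :
    Summable fun x : Λ => Complex.exp (π * Complex.I *
      (‖(x : EuclideanSpace ℝ (Fin n))‖ : ℂ) ^ 2 * (y * Complex.I)) := by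
  refine (Complex.summable_ofReal.2 h).congr fun x => ?_
  rw [Complex.ofReal_exp]
  congr 1
  push_cast
  linear_combination
    -(π * (‖(x : EuclideanSpace ℝ (Fin n))‖ : ℂ) ^ 2 * y) * Complex.I_sq

/-! ### The secrecy function of `E₈` -/

lemma secrecyFunction_latticeE8 (hy : 0 < y) :
    secrecyFunction latticeE8 y =
      thetaThree y ^ 8 / ((thetaTwo y ^ 8 + thetaThree y ^ 8 + thetaFour y ^ 8) / 2) := by
  rw [secrecyFunction, latticeTheta_mul_I, latticeTheta_mul_I, ← Complex.ofReal_div,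
    Complex.ofReal_re, (hasSum_integerLattice hy 8).tsum_eq, (hasSum_latticeE8 hy).tsum_eq]

lemma theta_sum_pos (hy : 0 < y) :
    0 < (thetaTwo y ^ 8 + thetaThree y ^ 8 + thetaFour y ^ 8) / 2 := by
  have := thetaThree_pos hy
  have : 0 ≤ thetaFour y ^ 8 := Even.pow_nonneg ⟨4, rfl⟩ _
  have : 0 ≤ thetaTwo y ^ 8 := Even.pow_nonneg ⟨4, rfl⟩ _
  positivity

lemma secrecyFunction_latticeE8_le (hy : 0 < y) : secrecyFunction latticeE8 y ≤ 4 / 3 := by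
  rw [secrecyFunction_latticeE8 hy, div_le_iff₀ (theta_sum_pos hy)]
  have h8 : thetaThree y ^ 8 = (thetaTwo y ^ 4 + thetaFour y ^ 4) ^ 2 := by
    rw [← thetaThree_pow_four hy]; ring
  rw [h8]
  linarith [sq_nonneg (thetaTwo y ^ 4 - thetaFour y ^ 4)]

lemma secrecyFunction_latticeE8_one : secrecyFunction latticeE8 1 = 4 / 3 := by
  rw [secrecyFunction_latticeE8 one_pos, div_eq_iff (theta_sum_pos one_pos).ne']
  have h8 : thetaThree 1 ^ 8 = (thetaTwo 1 ^ 4 + thetaFour 1 ^ 4) ^ 2 := by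
    rw [← thetaThree_pow_four one_pos]; ring
  rw [h8, thetaTwo_one]
  ring

end

/-- For every `y > 0` the two theta series in the definition of the secrecy function of `E₈`
converge absolutely, the denominator is nonzero, and `Ξ_{E₈}(y) ≤ Ξ_{E₈}(1)`. -/
theorem theorem3 (y : ℝ) (hy : 0 < y) :
    (Summable fun x : integerLattice 8 =>
      Complex.exp (Real.pi * Complex.I * (‖(x : EuclideanSpace ℝ (Fin 8))‖ : ℂ) ^ 2 *
        (y * Complex.I))) ∧
    (Summable fun x : latticeE8 =>
      Complex.exp (Real.pi * Complex.I * (‖(x : EuclideanSpace ℝ (Fin 8))‖ : ℂ) ^ 2 *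
        (y * Complex.I))) ∧
    latticeTheta latticeE8 (y * Complex.I) ≠ 0 ∧
    secrecyFunction latticeE8 y ≤ secrecyFunction latticeE8 1 := by
  refine ⟨summable_cexp_of_summable_exp (hasSum_integerLattice hy 8).summable,
    summable_cexp_of_summable_exp (hasSum_latticeE8 hy).summable, ?_, ?_⟩
  · rw [latticeTheta_mul_I, (hasSum_latticeE8 hy).tsum_eq]
    exact Complex.ofReal_ne_zero.2 (theta_sum_pos hy).ne'
  · rw [secrecyFunction_latticeE8_one]
    exact secrecyFunction_latticeE8_le hy
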